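/- **Setting.** Let $x(k+1)=Ax(k)+Bu(k)+w(k)$ with $x(k)\in\mathbb R^{n_x}$, $u(k)\in\mathbb R^{n_u}$, known (deterministic) initial state $x(0)$, and i.i.d. disturbances $w(k)\sim\mathcal D^w$. Let $X\subseteq\mathbb R^{n_x}$, $U\subseteq\mathbb R^{n_u}$ be convex sets containing the origin, $K$ a feedback gain, $A_K=A+BK$, and let $R_x,R_u\subseteq\mathbb R^{n_x}$ be the sets used for tightening: $$\mathcal Z:=X\ominus R_x,\qquad \mathcal V:=U\ominus KR_u,\qquad S\ominus T:=\{a\in S: a+b\in S\ \ \forall b\in T\}.$$ For a horizon $N\ge 1$ and positive definite $Q,Q_f,\bar R$, with $\|y\|_P^2=y^\top Py$, the nominal MPC problem with initial nominal state $z$ is $$\min_{z_0,\dots,z_N,\;v_0,\dots,v_{N-1}}\ \|z_N\|_{Q_f}^2+\sum_{i=0}^{N-1}\big(\|z_i\|_Q^2+\|v_i\|_{\bar R}^2\big)$$ subject to $z_0=z$, $z_N\in \mathcal Z_f$, and $z_{i+1}=Az_i+Bv_i$, $z_i\in\mathcal Z$, $v_i\in\mathcal V$ for $i=0,\dots,N-1$.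 The terminal set satisfies $\mathcal Z_f\subseteq\mathcal Z$ and, for all $z\in\mathcal Z_f$: $A_Kz\in\mathcal Z_f$, $Kz\in\mathcal V$, and $\|A_Kz\|_{Q_f}^2-\|z\|_{Q_f}^2\le-\|z\|_Q^2-\|Kz\|_{\bar R}^2$. A state $z$ is called feasible if the constraints can be satisfied. At every feasible $z$ the problem is assumed to have an optimal solution, and $v_0^*(z)$ denotes the first element of an optimal input sequence; the feasible set and the map $v_0^*$ are assumed measurable. **Closed loop.** The initial state $x(0)$ is feasible and $z(0)=x(0)$. The applied input is $u(k)=v(k)+Ke(k)$ with $v(k)=v_0^*(z(k))$ and $e(k)=x(k)-z(k)$ (so $e(0)=0$), and for $k\ge1$ the conditional update rule is $$z(k)=\begin{cases}x(k)&\text{if } x(k) \text{ is feasible},\\ z_1(k-1):=Az(k-1)+Bv(k-1)&\text{otherwise.}\end{cases}$$ **Predicted error.** $e_0=0$ and $e_{i+1}=A_Ke_i+w_i$ with $w_i$ i.i.d., $w_i\sim\mathcal D^w$. **Theorem.** Assume that $\mathcal D^w$ is central convex unimodal, i.e. it lies in the closed (in the topology of weak convergence) convex hull of the set of all uniform distributions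 on compact convex bodies $C\subset\mathbb R^{n_x}$ with $C=-C$ and nonempty interior. Let $R\subseteq\mathbb R^{n_x}$ be a (measurable) convex set with $R=-R$. Then $$\Pr(e(k)\in R)\ \ge\ \Pr(e_k\in R)\qquad\text{for all }k\ge 0.$$ Consequently, for every level $p$, if $R$ is a probabilistic reachable set of level $p$ for the predicted error (that is, $\Pr(e_k\in R)\ge p$ for all $k\ge0$ with $e_0=0$), then it is one for the closed-loop error: $e(0)=0$ and $\Pr(e(k)\in R)\ge p$ for all $k\ge0$. -/

import Mathlib

open MeasureTheory ProbabilityTheory Matrix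
open scoped NNReal ENNReal

namespace StochasticMPC

/-- A set is (centrally) symmetric if it is invariant under `x ↦ -x`. -/
def IsSymmetricSet {n : ℕ} (S : Set (Fin n → ℝ)) : Prop :=
  ∀ x ∈ S, -x ∈ S

/-- Symmetric compact convex bodies (compact convex sets with nonempty interior). -/
def IsSymmetricConvexBody {n : ℕ} (C : Set (Fin n → ℝ)) : Prop :=
  IsSymmetricSet C ∧ Convex ℝ C ∧ IsCompact C ∧ (interior C).Nonempty

/-- The uniform distributions on symmetric compact convex bodies, as finite measures:
the uniform distribution on `C` is Lebesgue measure conditioned on `C`. -/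
def symmetricUniforms (n : ℕ) : Set (FiniteMeasure (Fin n → ℝ)) :=
  {ν | ∃ C : Set (Fin n → ℝ), IsSymmetricConvexBody C ∧
    (ν : Measure (Fin n → ℝ)) = ProbabilityTheory.cond volume C}

/-- Central convex unimodality: membership in the closed convex hull of the uniform distributions
on symmetric compact convex bodies; the topology is that of weak convergence of measures. -/
def IsCentralConvexUnimodal {n : ℕ} (μ : ProbabilityMeasure (Fin n → ℝ)) : Prop :=
  μ.toFiniteMeasure ∈ closure (convexHull ℝ≥0 (symmetricUniforms n))

/-- The Pontryagin set difference `S ⊖ T`. -/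
def pontryaginDiff {n : ℕ} (S T : Set (Fin n → ℝ)) : Set (Fin n → ℝ) :=
  {a | a ∈ S ∧ ∀ b ∈ T, a + b ∈ S}

/-- The squared weighted norm `‖x‖_P² = xᵀ P x`. -/
def wnormSq {n : ℕ} (P : Matrix (Fin n) (Fin n) ℝ) (x : Fin n → ℝ) : ℝ :=
  x ⬝ᵥ (P *ᵥ x)

/-- Data of the controlled linear system and of the nominal MPC problem with state dimension `nx`,
input dimension `nu` and horizon `N`. -/
structure Problem (nx nu N : ℕ) where
  /-- system matrix -/
  A : Matrix (Fin nx) (Fin nx) ℝ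
  /-- input matrix -/
  B : Matrix (Fin nx) (Fin nu) ℝ
  /-- auxiliary feedback gain -/
  K : Matrix (Fin nu) (Fin nx) ℝ
  /-- state stage cost -/
  Q : Matrix (Fin nx) (Fin nx) ℝ
  /-- terminal cost -/
  Qf : Matrix (Fin nx) (Fin nx) ℝ
  /-- input stage cost -/
  Rc : Matrix (Fin nu) (Fin nu) ℝ
  /-- state constraint set -/
  X : Set (Fin nx → ℝ)
  /-- input constraint set -/
  U : Set (Fin nu → ℝ)
  /-- error set used for tightening the state constraint -/
  Rx : Set (Fin nx → ℝ)
  /-- error set used for tightening the input constraint -/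
  Ru : Set (Fin nx → ℝ)
  /-- terminal set -/
  Zf : Set (Fin nx → ℝ)

namespace Problem

variable {nx nu N : ℕ} (M : Problem nx nu N)

/-- The closed-loop matrix `A_K = A + B K` of the linear error dynamics. -/
def AK : Matrix (Fin nx) (Fin nx) ℝ := M.A + M.B * M.K

/-- The tightened state constraint set `X ⊖ R_x`. -/
def tightX : Set (Fin nx → ℝ) := pontryaginDiff M.X M.Rx

/-- The tightened input constraint set `U ⊖ K R_u`. -/
def tightU : Set (Fin nu → ℝ) := pontryaginDiff M.U ((fun e => M.K *ᵥ e) '' M.Ru)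

/-- The standing assumptions on the design: convex constraint sets containing the origin, positive
definite weights, and the usual requirements on the terminal set and terminal cost. -/
structure StandingAssumptions : Prop where
  convex_X : Convex ℝ M.X
  zero_mem_X : 0 ∈ M.X
  convex_U : Convex ℝ M.U
  zero_mem_U : 0 ∈ M.U
  posDef_Q : M.Q.PosDef
  posDef_Qf : M.Qf.PosDef
  posDef_Rc : M.Rc.PosDef
  terminal_subset : M.Zf ⊆ M.tightX
  terminal_invariant : ∀ z ∈ M.Zf, M.AK *ᵥ z ∈ M.Zf
  terminal_input : ∀ z ∈ M.Zf, M.K *ᵥ z ∈ M.tightU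
  terminal_decrease : ∀ z ∈ M.Zf,
    wnormSq M.Qf (M.AK *ᵥ z) - wnormSq M.Qf z ≤ -wnormSq M.Q z - wnormSq M.Rc (M.K *ᵥ z)

/-- `(Z, V)` satisfies the constraints of the nominal MPC problem with initial nominal state `z`. -/
def IsFeasiblePair (z : Fin nx → ℝ) (Z : Fin (N + 1) → Fin nx → ℝ) (V : Fin N → Fin nu → ℝ) :
    Prop :=
  Z 0 = z ∧
  (∀ i : Fin N, Z i.succ = M.A *ᵥ Z i.castSucc + M.B *ᵥ V i) ∧
  (∀ i : Fin N, Z i.castSucc ∈ M.tightX) ∧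
  (∀ i : Fin N, V i ∈ M.tightU) ∧
  Z (Fin.last N) ∈ M.Zf

/-- The cost of the nominal MPC problem. -/
def cost (Z : Fin (N + 1) → Fin nx → ℝ) (V : Fin N → Fin nu → ℝ) : ℝ :=
  wnormSq M.Qf (Z (Fin.last N)) +
    ∑ i : Fin N, (wnormSq M.Q (Z i.castSucc) + wnormSq M.Rc (V i))

/-- The nominal MPC problem is feasible for the initial nominal state `z`. -/
def Feasible (z : Fin nx → ℝ) : Prop :=
  ∃ Z V, M.IsFeasiblePair z Z V

/-- `(Z, V)` solves the nominal MPC problem with initial nominal state `z`. -/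
def IsOptimalPair (z : Fin nx → ℝ) (Z : Fin (N + 1) → Fin nx → ℝ) (V : Fin N → Fin nu → ℝ) :
    Prop :=
  M.IsFeasiblePair z Z V ∧ ∀ Z' V', M.IsFeasiblePair z Z' V' → M.cost Z V ≤ M.cost Z' V'

/-- `κ` is a nominal MPC law `z ↦ v₀*(z)`: at every feasible state `z` it returns the first element
of an optimal input sequence. (Its values at infeasible states are irrelevant.) -/
def IsMPCLaw [NeZero N] (κ : (Fin nx → ℝ) → Fin nu → ℝ) : Prop :=
  ∀ z, M.Feasible z → ∃ Z V, M.IsOptimalPair z Z V ∧ V 0 = κ z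

open Classical in
/-- The closed-loop pair `(x(k), z(k))` along the disturbance path `w`, started at the feasible
state `x0` (so that `z(0) = x(0)`). The applied input is `u = v + K e` with `v = κ(z)` and
`e = x - z`; the conditional update sets `z(k+1) = x(k+1)` if that is feasible and
`z(k+1) = z₁(k) = A z(k) + B v(k)` otherwise. -/
noncomputable def closedLoop (κ : (Fin nx → ℝ) → Fin nu → ℝ) (x0 : Fin nx → ℝ)
    (w : ℕ → Fin nx → ℝ) : ℕ → (Fin nx → ℝ) × (Fin nx → ℝ)
  | 0 => (x0, x0)
  | k + 1 =>
    let x := (closedLoop κ x0 w k).1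
    let z := (closedLoop κ x0 w k).2
    let v := κ z
    let u := v + M.K *ᵥ (x - z)
    let xnext := M.A *ᵥ x + M.B *ᵥ u + w k
    let znext := if M.Feasible xnext then xnext else M.A *ᵥ z + M.B *ᵥ v
    (xnext, znext)

/-- The closed-loop error `e(k) = x(k) - z(k)`. -/
noncomputable def closedLoopError (κ : (Fin nx → ℝ) → Fin nu → ℝ) (x0 : Fin nx → ℝ)
    (w : ℕ → Fin nx → ℝ) (k : ℕ) : Fin nx → ℝ :=
  (M.closedLoop κ x0 w k).1 - (M.closedLoop κ x0 w k).2

/-- The predicted error along the disturbance path `w`: `e₀ = 0`, `e_{i+1} = (A + B K) e_i + w_i`. -/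
def predictedError (w : ℕ → Fin nx → ℝ) : ℕ → Fin nx → ℝ
  | 0 => 0
  | i + 1 => M.AK *ᵥ predictedError w i + w i

end Problem

/-- `w` is an i.i.d. sequence of random vectors with distribution `μ`. -/
def IsIIDWithLaw {n : ℕ} {Ω : Type*} [MeasurableSpace Ω] (P : Measure Ω)
    (w : ℕ → Ω → Fin n → ℝ) (μ : ProbabilityMeasure (Fin n → ℝ)) : Prop :=
  (∀ k, Measurable (w k)) ∧ iIndepFun w P ∧ ∀ k, P.map (w k) = (μ : Measure (Fin n → ℝ))

/-- `R` is a probabilistic reachable set of probability level `p` for the error process `e`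
(a process started at the origin). -/
def IsPRS {n : ℕ} {Ω : Type*} [MeasurableSpace Ω] (P : Measure Ω)
    (e : ℕ → Ω → Fin n → ℝ) (R : Set (Fin n → ℝ)) (p : ℝ) : Prop :=
  (∀ ω, e 0 ω = 0) ∧ ∀ k, p ≤ P.real {ω | e k ω ∈ R}

end StochasticMPC

/-!
Write `e` for the closed-loop error and `ê` for the predicted error. At each step the conditional
update either resets the closed-loop error to `0` or leaves `e (k + 1) = A_K e k + w k`
(`Problem.closedLoopError_succ`). A nonempty convex symmetric set contains `0`, so a reset can only
help membership, and it suffices to compare `A_K e k + w k` with `A_K ê k + w k`, where in both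
cases the disturbance is independent of the error it is added to.

The comparison is carried by the peakedness order `PeakedLE ν' ν`, which says `ν' S ≤ ν S` for every
closed convex symmetric set `S`. It is plainly preserved by linear maps, and the point is that it is
preserved by convolution with a central convex unimodal law `μ` (`PeakedLE.conv`). For this, the
indicator of `S` is replaced by its thickened indicator `f`, a continuous symmetric function
with `f x * f y ≤ f (midpoint x y) ^ 2`. For `f` continuous, the inequality
`∫∫ f (y + w) dν'(y) dμ(w) ≤ ∫∫ f (y + w) dν(y) dμ(w)` is a closed convex condition on `μ`, so it
need only be checked when `μ` is uniform on a symmetric convex body `C`. In that case the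
Prékopa–Leindler inequality (`prekopaLeindler`) shows that `y ↦ ∫_C f (y + w) dw` is midpoint
log-concave, hence has closed convex symmetric superlevel sets, and the layer cake formula gives the
inequality from `PeakedLE ν' ν` (`PeakedLE.lintegral_le`).

By induction on `k` the law of `e k` is at least as peaked as that of `ê k`. Inner regularity
and compactness of convex hulls of compact sets pass from closed sets to an arbitrary measurable
convex symmetric set (`PeakedLE.measure_le`).
-/

namespace StochasticMPC

open Filter Topology Metric
open scoped BoundedContinuousFunction

/-! ### The Prékopa–Leindler inequality -/

/-- The one-dimensional Brunn–Minkowski inequality for compact sets: the translates `K + min L` and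
`max K + L` both lie in `K + L` and overlap in at most one point. -/
theorem volume_add_volume_le_of_isCompact {K L T : Set ℝ} (hK : IsCompact K) (hL : IsCompact L)
    (hK₀ : K.Nonempty) (hL₀ : L.Nonempty) (hT : ∀ x ∈ K, ∀ y ∈ L, x + y ∈ T) :
    volume K + volume L ≤ volume T := by
  have ha := hK.sSup_mem hK₀
  have hb := hL.sInf_mem hL₀
  set a := sSup K
  set b := sInf L
  have hKa : ∀ x ∈ K, x ≤ a := fun x hx => le_csSup hK.bddAbove hx
  have hLb : ∀ y ∈ L, b ≤ y := fun y hy => csInf_le hL.bddBelow hy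
  have hdisj : AEDisjoint volume ((fun x => x + b) '' K) ((fun y => a + y) '' L) := by
    refine measure_mono_null (t := {a + b}) ?_ (by simp)
    rintro _ ⟨⟨x, hx, rfl⟩, ⟨y, hy, hxy⟩⟩
    have h1 := hKa x hx
    have h2 := hLb y hy
    simp only [Set.mem_singleton_iff] at hxy ⊢
    linarith
  have hmeas : MeasurableSet ((fun y => a + y) '' L) :=
    (hL.image (by fun_prop)).measurableSet
  calc volume K + volume L
      = volume ((fun x => x + b) '' K) + volume ((fun y => a + y) '' L) := by
        simp [Set.image_add_right, Set.image_add_left]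
    _ = volume ((fun x => x + b) '' K ∪ (fun y => a + y) '' L) :=
        (measure_union₀ hmeas.nullMeasurableSet hdisj).symm
    _ ≤ volume T := by
        refine measure_mono (Set.union_subset ?_ ?_)
        · rintro _ ⟨x, hx, rfl⟩
          exact hT x hx b hb
        · rintro _ ⟨y, hy, rfl⟩
          exact hT a ha y hy

/-- The one-dimensional Brunn–Minkowski inequality for measurable sets. A superset `T` of the sumset
takes the place of the sumset itself, which need not be measurable. -/
theorem volume_add_volume_le {K L T : Set ℝ} (hK : MeasurableSet K) (hL : MeasurableSet L)
    (hK₀ : K.Nonempty) (hL₀ : L.Nonempty) (hT : ∀ x ∈ K, ∀ y ∈ L, x + y ∈ T) :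
    volume K + volume L ≤ volume T := by
  obtain ⟨x₀, hx₀⟩ := hK₀
  obtain ⟨y₀, hy₀⟩ := hL₀
  rw [hK.measure_eq_iSup_isCompact, hL.measure_eq_iSup_isCompact]
  simp only [iSup_and']
  refine ENNReal.biSup_add_biSup_le' ⟨∅, by simp, isCompact_empty⟩
    ⟨∅, by simp, isCompact_empty⟩ ?_
  rintro K' ⟨hK', hKc⟩ L' ⟨hL', hLc⟩
  -- adjoining a point makes the compact approximants nonempty
  calc volume K' + volume L' ≤ volume (insert x₀ K') + volume (insert y₀ L') := by
        gcongr <;> exact Set.subset_insert _ _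
    _ ≤ volume T := by
        refine volume_add_volume_le_of_isCompact (hKc.insert _) (hLc.insert _)
          (Set.insert_nonempty _ _) (Set.insert_nonempty _ _) fun x hx y hy => hT x ?_ y ?_
        · exact Set.insert_subset hx₀ hK' hx
        · exact Set.insert_subset hy₀ hL' hy

/-- The layer cake formula for `ℝ≥0∞`-valued functions bounded by `1`. -/
theorem lintegral_eq_lintegral_Ioo_meas_lt {α : Type*} [MeasurableSpace α] {ν : Measure α}
    {f : α → ℝ≥0∞} (hf : Measurable f) (hf1 : ∀ x, f x ≤ 1) :
    ∫⁻ x, f x ∂ν = ∫⁻ t in Set.Ioo (0 : ℝ) 1, ν {x | ENNReal.ofReal t < f x} := by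
  have hfin : ∀ x, f x ≠ ∞ := fun x => ((hf1 x).trans_lt ENNReal.one_lt_top).ne
  have h1 : ∫⁻ x, f x ∂ν = ∫⁻ x, ENNReal.ofReal (f x).toReal ∂ν := by
    simp [ENNReal.ofReal_toReal, hfin]
  have h2 : ∀ t ∈ Set.Ioi (0 : ℝ),
      ν {x | t < (f x).toReal} = ν {x | ENNReal.ofReal t < f x} := by
    intro t ht
    congr 1
    ext x
    simp [ENNReal.ofReal_lt_iff_lt_toReal (le_of_lt ht) (hfin x)]
  rw [h1, lintegral_eq_lintegral_meas_lt _ (by filter_upwards with x; positivity)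
    hf.ennreal_toReal.aemeasurable, setLIntegral_congr_fun measurableSet_Ioi h2]
  rw [← Set.Ioo_union_Ici_eq_Ioi (show (0 : ℝ) < 1 by norm_num),
    lintegral_union measurableSet_Ici (by
      rw [Set.disjoint_left]; intro x hx hx'; exact not_lt.2 hx' hx.2)]
  have h3 : ∀ t ∈ Set.Ici (1 : ℝ), ν {x | ENNReal.ofReal t < f x} = 0 := by
    intro t ht
    have : {x | ENNReal.ofReal t < f x} = ∅ := by
      ext x
      simpa using (hf1 x).trans (by simpa using ht)
    simp [this]
  rw [setLIntegral_congr_fun measurableSet_Ici h3]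
  simp

/-- For functions with supremum `1` the one-dimensional Prékopa–Leindler inequality holds with the
arithmetic mean on the left: the superlevel sets of `f` and `g` at each height below `1` are
nonempty, so Brunn–Minkowski applies to them. -/
theorem lintegral_add_le_of_iSup_eq_one {f g h : ℝ → ℝ≥0∞} (hf : Measurable f)
    (hg : Measurable g) (hh : Measurable h) (hf1 : ⨆ x, f x = 1) (hg1 : ⨆ x, g x = 1)
    (H : ∀ x y, f x * g y ≤ h ((x + y) / 2) ^ 2) :
    (∫⁻ x, f x) + (∫⁻ x, g x) ≤ 2 * ∫⁻ x, h x := by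
  have hle : ∀ (φ : ℝ → ℝ≥0∞), ⨆ x, φ x = 1 → ∀ x, φ x ≤ 1 := fun φ hφ x => hφ ▸ le_iSup φ x
  have hmono : ∀ (φ : ℝ → ℝ≥0∞), Measurable fun t : ℝ => volume {x | ENNReal.ofReal t < φ x} :=
    fun φ => Antitone.measurable fun s t hst => measure_mono fun x hx =>
      (ENNReal.ofReal_le_ofReal hst).trans_lt hx
  calc (∫⁻ x, f x) + (∫⁻ x, g x)
      = ∫⁻ t in Set.Ioo (0 : ℝ) 1, (volume {x | ENNReal.ofReal t < f x} +
          volume {x | ENNReal.ofReal t < g x}) := by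
        rw [lintegral_eq_lintegral_Ioo_meas_lt hf (hle f hf1),
          lintegral_eq_lintegral_Ioo_meas_lt hg (hle g hg1), lintegral_add_left (hmono f)]
    -- truncating `h` at `1` makes the layer cake formula applicable and keeps the levels `t < 1`
    _ ≤ ∫⁻ t in Set.Ioo (0 : ℝ) 1, 2 * volume {x | ENNReal.ofReal t < min (h x) 1} := by
        refine setLIntegral_mono' measurableSet_Ioo fun t ht => ?_
        have ht1 : ENNReal.ofReal t < 1 := by simpa using ht.2
        have hne : ∀ (φ : ℝ → ℝ≥0∞), ⨆ x, φ x = 1 → {x | ENNReal.ofReal t < φ x}.Nonempty :=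
          fun φ hφ => lt_iSup_iff.1 (ht1.trans_eq hφ.symm)
        have h2 : 2 * volume {x | ENNReal.ofReal t < min (h x) 1} =
            volume ((fun z => (2⁻¹ : ℝ) * z) ⁻¹' {x | ENNReal.ofReal t < min (h x) 1}) := by
          rw [Real.volume_preimage_mul_left (by norm_num)]
          simp
        rw [h2]
        refine volume_add_volume_le (hf measurableSet_Ioi) (hg measurableSet_Ioi)
          (hne f hf1) (hne g hg1) fun x hx y hy => ?_
        have hlt : ENNReal.ofReal t * ENNReal.ofReal t < h ((x + y) / 2) ^ 2 :=
          (ENNReal.mul_lt_mul hx hy).trans_le (H x y)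
        rw [← sq] at hlt
        have := lt_of_pow_lt_pow_left' 2 hlt
        simp only [Set.mem_preimage, Set.mem_ofPred_eq, lt_min_iff]
        exact ⟨by rwa [inv_mul_eq_div], ht1⟩
    _ = 2 * ∫⁻ x, min (h x) 1 := by
        rw [lintegral_const_mul _ (hmono _), lintegral_eq_lintegral_Ioo_meas_lt
          (hh.min measurable_const) fun x => min_le_right _ _]
    _ ≤ 2 * ∫⁻ x, h x := by
        gcongr with x
        exact min_le_left _ _

theorem four_mul_le_add_sq (a b : ℝ≥0∞) : 4 * (a * b) ≤ (a + b) ^ 2 := by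
  by_cases ha : a = ∞
  · simp [ha]
  by_cases hb : b = ∞
  · simp [hb]
  lift a to ℝ≥0 using ha
  lift b to ℝ≥0 using hb
  norm_cast
  rw [← NNReal.coe_le_coe]
  push_cast
  nlinarith [sq_nonneg ((a : ℝ) - b)]

/-- The bounded case, by dividing `f`, `g`, `h` by `⨆ f`, `⨆ g` and the geometric mean of the two. -/
theorem prekopaLeindler_real_of_bounded {f g h : ℝ → ℝ≥0∞} (hf : Measurable f)
    (hg : Measurable g) (hh : Measurable h) (hf1 : ⨆ x, f x ≠ ∞) (hg1 : ⨆ x, g x ≠ ∞)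
    (H : ∀ x y, f x * g y ≤ h ((x + y) / 2) ^ 2) :
    (∫⁻ x, f x) * ∫⁻ x, g x ≤ (∫⁻ x, h x) ^ 2 := by
  set F := ⨆ x, f x with hF
  set G := ⨆ x, g x with hG
  by_cases hF0 : F = 0
  · have : ∀ x, f x = 0 := by simpa [hF] using hF0
    simp [this]
  by_cases hG0 : G = 0
  · have : ∀ x, g x = 0 := by simpa [hG] using hG0
    simp [this]
  set c : ℝ≥0∞ := (F * G) ^ (2⁻¹ : ℝ) with hc
  have hc2 : c ^ 2 = F * G := by
    rw [hc, ← ENNReal.rpow_natCast, ← ENNReal.rpow_mul]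
    simp
  have hFG : F * G ≠ 0 := mul_ne_zero hF0 hG0
  have key := lintegral_add_le_of_iSup_eq_one (hf.const_mul F⁻¹) (hg.const_mul G⁻¹)
    (hh.const_mul c⁻¹) (by rw [← ENNReal.mul_iSup, ENNReal.inv_mul_cancel hF0 hf1])
    (by rw [← ENNReal.mul_iSup, ENNReal.inv_mul_cancel hG0 hg1]) (fun x y => by
      rw [mul_pow, ← ENNReal.inv_pow, hc2, ENNReal.mul_inv (.inl hF0) (.inl hf1), mul_mul_mul_comm]
      gcongr
      exact H x y)
  rw [lintegral_const_mul _ hf, lintegral_const_mul _ hg, lintegral_const_mul _ hh] at key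
  -- the arithmetic-geometric mean inequality, multiplied by `4` and by `(F * G)⁻¹`
  have h4 : 4 * ((F * G)⁻¹ * ((∫⁻ x, f x) * ∫⁻ x, g x)) ≤
      4 * ((F * G)⁻¹ * (∫⁻ x, h x) ^ 2) := by
    calc _ = 4 * ((F⁻¹ * ∫⁻ x, f x) * (G⁻¹ * ∫⁻ x, g x)) := by
          rw [ENNReal.mul_inv (.inl hF0) (.inl hf1), mul_mul_mul_comm]
      _ ≤ _ := four_mul_le_add_sq _ _
      _ ≤ _ := pow_le_pow_left₀ (zero_le) key 2
      _ = _ := by rw [mul_pow, mul_pow, ← ENNReal.inv_pow, hc2]; norm_num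
  rw [ENNReal.mul_le_mul_iff_right (by norm_num) (by norm_num), ENNReal.mul_le_mul_iff_right
    (ENNReal.inv_ne_zero.2 (ENNReal.mul_ne_top hf1 hg1)) (ENNReal.inv_ne_top.2 hFG)] at h4
  exact h4

theorem lintegral_eq_iSup_lintegral_min {α : Type*} [MeasurableSpace α] {ν : Measure α}
    {f : α → ℝ≥0∞} (hf : Measurable f) :
    ∫⁻ x, f x ∂ν = ⨆ n : ℕ, ∫⁻ x, min (f x) n ∂ν := by
  rw [← lintegral_iSup (fun n => hf.min measurable_const)
    (fun m n hmn x => min_le_min_left _ (by exact_mod_cast hmn))]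
  congr 1
  ext x
  rw [← inf_iSup_eq, ENNReal.iSup_natCast, inf_top_eq]

/-- The one-dimensional Prékopa–Leindler inequality with weights `1/2`. Squaring the right-hand sides
avoids fractional powers. -/
theorem prekopaLeindler_real {f g h : ℝ → ℝ≥0∞} (hf : Measurable f)
    (hg : Measurable g) (hh : Measurable h)
    (H : ∀ x y, f x * g y ≤ h ((x + y) / 2) ^ 2) :
    (∫⁻ x, f x) * ∫⁻ x, g x ≤ (∫⁻ x, h x) ^ 2 := by
  have hb : ∀ (φ : ℝ → ℝ≥0∞) (n : ℕ), ⨆ x, min (φ x) n ≠ ∞ := fun φ n =>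
    ((iSup_le fun x => min_le_right _ _).trans_lt (ENNReal.natCast_lt_top n)).ne
  rw [lintegral_eq_iSup_lintegral_min hf, lintegral_eq_iSup_lintegral_min hg]
  rw [ENNReal.iSup_mul]
  refine iSup_le fun m => ?_
  rw [ENNReal.mul_iSup]
  refine iSup_le fun n => prekopaLeindler_real_of_bounded (hf.min measurable_const)
    (hg.min measurable_const) hh (hb f m) (hb g n) fun x y => le_trans ?_ (H x y)
  gcongr <;> exact min_le_left _ _

theorem lintegral_pi_fin_succ {n : ℕ} {f : (Fin (n + 1) → ℝ) → ℝ≥0∞} (hf : Measurable f) :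
    ∫⁻ x, f x = ∫⁻ a : ℝ, ∫⁻ y : Fin n → ℝ, f (Fin.cons a y) := by
  have e := (volume_preserving_piFinSuccAbove (fun _ : Fin (n + 1) => ℝ) 0).symm
  rw [← e.lintegral_comp hf, Measure.volume_eq_prod]
  refine (lintegral_prod _ (hf.comp e.measurable).aemeasurable).trans ?_
  simp [MeasurableEquiv.piFinSuccAbove_symm_apply, Fin.consEquiv]

theorem measurable_fin_cons {n : ℕ} :
    Measurable fun p : ℝ × (Fin n → ℝ) => (Fin.cons p.1 p.2 : Fin (n + 1) → ℝ) := by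
  refine measurable_pi_lambda _ fun i => ?_
  refine Fin.cases ?_ (fun j => ?_) i
  · exact measurable_fst
  · simp only [Fin.cons_succ]
    fun_prop

/-- The Prékopa–Leindler inequality with weights `1/2`, by induction on the dimension: fixing the
first coordinate, the hypothesis passes to the marginals by the induction hypothesis. -/
theorem prekopaLeindler {n : ℕ} {f g h : (Fin n → ℝ) → ℝ≥0∞} (hf : Measurable f)
    (hg : Measurable g) (hh : Measurable h)
    (H : ∀ x y, f x * g y ≤ h (midpoint ℝ x y) ^ 2) :
    (∫⁻ x, f x) * ∫⁻ x, g x ≤ (∫⁻ x, h x) ^ 2 := by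
  induction n with
  | zero =>
    have hd : (volume : Measure (Fin 0 → ℝ)) = Measure.dirac 0 := by
      rw [volume_pi, Measure.pi_of_empty _ 0]
    rw [hd, lintegral_dirac, lintegral_dirac, lintegral_dirac]
    simpa using H 0 0
  | succ n ih =>
    have hm : ∀ {φ : (Fin (n + 1) → ℝ) → ℝ≥0∞}, Measurable φ →
        Measurable fun p : ℝ × (Fin n → ℝ) => φ (Fin.cons p.1 p.2) :=
      fun hφ => hφ.comp measurable_fin_cons
    rw [lintegral_pi_fin_succ hf, lintegral_pi_fin_succ hg, lintegral_pi_fin_succ hh]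
    refine prekopaLeindler_real (hm hf).lintegral_prod_right' (hm hg).lintegral_prod_right'
      (hm hh).lintegral_prod_right' fun a b => ?_
    refine ih ((hm hf).comp measurable_prodMk_left) ((hm hg).comp measurable_prodMk_left)
      ((hm hh).comp measurable_prodMk_left) fun x y => ?_
    convert H (Fin.cons a x) (Fin.cons b y) using 3
    ext i
    refine Fin.cases ?_ (fun j => ?_) i
    · simp [midpoint_eq_smul_add]; ring
    · simp [midpoint_eq_smul_add]; ring

/-! ### The peakedness order and convolution -/

/-- A closed set containing the midpoints of its points is convex: a point of a segment outside the
set would lie in a gap `(a, b)` whose midpoint belongs to the set. -/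
theorem convex_of_isClosed_of_midpoint_mem {E : Type*} [AddCommGroup E] [Module ℝ E]
    [TopologicalSpace E] [ContinuousAdd E] [ContinuousSMul ℝ E] {S : Set E} (hS : IsClosed S)
    (hmid : ∀ x ∈ S, ∀ y ∈ S, midpoint ℝ x y ∈ S) : Convex ℝ S := by
  rw [convex_iff_segment_subset]
  intro x hx y hy
  rw [segment_eq_image]
  rintro _ ⟨t, ht, rfl⟩
  set γ : ℝ → E := fun s => (1 - s) • x + s • y with hγ
  have hγc : Continuous γ := by fun_prop
  set T : Set ℝ := Set.Icc 0 1 ∩ γ ⁻¹' S with hT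
  have hTc : IsCompact T := isCompact_Icc.inter_right (hS.preimage hγc)
  have h0 : (0 : ℝ) ∈ T := ⟨by simp, by simpa [hγ] using hx⟩
  have h1 : (1 : ℝ) ∈ T := ⟨by simp, by simpa [hγ] using hy⟩
  -- the gap around `t` is the interval from `a` to `b`
  obtain ⟨⟨haT, hat⟩, ha⟩ := (hTc.inter_right isClosed_Iic).isGreatest_sSup ⟨0, h0, ht.1⟩
  obtain ⟨⟨hbT, hbt⟩, hb⟩ := (hTc.inter_right isClosed_Ici).isLeast_sInf ⟨1, h1, ht.2⟩
  set a := sSup (T ∩ Set.Iic t)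
  set b := sInf (T ∩ Set.Ici t)
  simp only [Set.mem_Iic, Set.mem_Ici] at hat hbt
  have hm : (a + b) / 2 ∈ T := by
    refine ⟨⟨by linarith [haT.1.1, hbT.1.1], by linarith [haT.1.2, hbT.1.2]⟩, ?_⟩
    have := hmid _ haT.2 _ hbT.2
    have e : midpoint ℝ (γ a) (γ b) = γ ((a + b) / 2) := by
      simp only [hγ, midpoint_eq_smul_add, invOf_eq_inv]
      module
    rwa [e] at this
  rcases le_total ((a + b) / 2) t with h | h
  · have := ha ⟨hm, h⟩
    have hbt' : t = a := by linarith
    rw [hbt']; exact haT.2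
  · have := hb ⟨hm, h⟩
    have hat' : t = b := by linarith
    rw [hat']; exact hbT.2

/-- The peakedness order: `ν` gives every closed convex symmetric set at least the mass that `ν'`
gives it. Restricting to closed sets loses nothing, see `PeakedLE.measure_le`. -/
def PeakedLE {n : ℕ} (ν' ν : Measure (Fin n → ℝ)) : Prop :=
  ∀ S : Set (Fin n → ℝ), IsClosed S → Convex ℝ S → IsSymmetricSet S → ν' S ≤ ν S

/-- The peakedness order extends from sets to continuous symmetric midpoint log-concave functions,
because the superlevel sets of such a function are closed, convex and symmetric. -/
theorem PeakedLE.lintegral_le {n : ℕ} {ν' ν : Measure (Fin n → ℝ)} (hν : PeakedLE ν' ν)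
    {h : (Fin n → ℝ) → ℝ≥0} (hc : Continuous h) (hs : ∀ x, h (-x) = h x)
    (hm : ∀ x y, h x * h y ≤ h (midpoint ℝ x y) ^ 2) :
    ∫⁻ x, h x ∂ν' ≤ ∫⁻ x, h x ∂ν := by
  have hlc : ∀ ρ : Measure (Fin n → ℝ),
      ∫⁻ x, h x ∂ρ = ∫⁻ t in Set.Ioi (0 : ℝ), ρ {x | t ≤ (h x : ℝ)} := fun ρ => by
    rw [← lintegral_eq_lintegral_meas_le (f := fun x => (h x : ℝ)) ρ
      (.of_forall fun x => (h x).2) (by fun_prop)]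
    simp
  rw [hlc, hlc]
  refine setLIntegral_mono' measurableSet_Ioi fun t ht => ?_
  have ht0 : 0 < t := ht
  have hcl : IsClosed {x | t ≤ (h x : ℝ)} := isClosed_le continuous_const (by fun_prop)
  refine hν _ hcl (convex_of_isClosed_of_midpoint_mem hcl fun x hx y hy => ?_) fun x hx => ?_
  · have h1 : t ≤ (h x : ℝ) := hx
    have h2 : t ≤ (h y : ℝ) := hy
    have h3 : (h x : ℝ) * h y ≤ (h (midpoint ℝ x y) : ℝ) ^ 2 := by exact_mod_cast hm x y
    have h4 : t ^ 2 ≤ (h (midpoint ℝ x y) : ℝ) ^ 2 := by nlinarith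
    exact le_of_sq_le_sq h4 (h _).2
  · simpa [hs] using hx

theorem lintegral_translate_le {n : ℕ} (ν : Measure (Fin n → ℝ)) (f : (Fin n → ℝ) →ᵇ ℝ≥0)
    (w : Fin n → ℝ) : ∫⁻ y, f (y + w) ∂ν ≤ nndist f 0 * ν Set.univ := by
  rw [← lintegral_const]
  exact lintegral_mono fun y =>
    ENNReal.coe_le_coe.2 (BoundedContinuousFunction.NNReal.upper_bound _ _)

theorem continuous_lintegral_translate {n : ℕ} (ν : Measure (Fin n → ℝ)) [IsFiniteMeasure ν]
    (f : (Fin n → ℝ) →ᵇ ℝ≥0) : Continuous fun w => (∫⁻ y, f (y + w) ∂ν).toNNReal := by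
  let F : (Fin n → ℝ) → (Fin n → ℝ) →ᵇ ℝ≥0 := fun w =>
    f.compContinuous ⟨fun y => y + w, by fun_prop⟩
  let ν₀ : FiniteMeasure (Fin n → ℝ) := ⟨ν, inferInstance⟩
  refine continuous_iff_continuousAt.2 fun w => ?_
  have hlim : ∀ y, Tendsto (fun v => F v y) (𝓝 w) (𝓝 (F w y)) := fun y =>
    (f.continuous.comp (continuous_const.add continuous_id)).tendsto w
  exact FiniteMeasure.tendsto_testAgainstNN_filter_of_le_const (μ := ν₀) (fs := F) (f := F w)
    (c := nndist f 0)
    (.of_forall fun v => .of_forall fun y =>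
      BoundedContinuousFunction.NNReal.upper_bound f (y + v))
    (.of_forall hlim)

/-- The average `w ↦ ∫ f (y + w) dν(y)` of the translates of `f`, again a nonnegative bounded
continuous function. The integral is finite, so `toNNReal` does not lose information, see
`coe_translationAverage`. -/
noncomputable def translationAverage {n : ℕ} (ν : Measure (Fin n → ℝ)) [IsFiniteMeasure ν]
    (f : (Fin n → ℝ) →ᵇ ℝ≥0) : (Fin n → ℝ) →ᵇ ℝ≥0 :=
  BoundedContinuousFunction.mkOfBound ⟨_, continuous_lintegral_translate ν f⟩
    (nndist f 0 * ν Set.univ).toReal fun x y => by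
      have hb : ∀ w, ((∫⁻ y, f (y + w) ∂ν).toNNReal : ℝ) ≤ (nndist f 0 * ν Set.univ).toReal :=
        fun w => ENNReal.toReal_mono (by finiteness) (lintegral_translate_le ν f w)
      exact abs_sub_le_of_nonneg_of_le (NNReal.coe_nonneg _) (hb x) (NNReal.coe_nonneg _) (hb y)

theorem coe_translationAverage {n : ℕ} (ν : Measure (Fin n → ℝ)) [IsFiniteMeasure ν]
    (f : (Fin n → ℝ) →ᵇ ℝ≥0) (w : Fin n → ℝ) :
    (translationAverage ν f w : ℝ≥0∞) = ∫⁻ y, f (y + w) ∂ν :=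
  ENNReal.coe_toNNReal
    ((f.compContinuous ⟨fun y => y + w, by fun_prop⟩).lintegral_lt_top_of_nnreal ν).ne

theorem lintegral_translationAverage_comm {n : ℕ} (ν ρ : Measure (Fin n → ℝ)) [IsFiniteMeasure ν]
    [IsFiniteMeasure ρ] (f : (Fin n → ℝ) →ᵇ ℝ≥0) :
    ∫⁻ w, translationAverage ν f w ∂ρ = ∫⁻ y, translationAverage ρ f y ∂ν := by
  simp_rw [coe_translationAverage]
  rw [lintegral_lintegral_swap]
  · simp_rw [add_comm]
  · exact (by fun_prop : Continuous fun p : (Fin n → ℝ) × (Fin n → ℝ) =>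
      f (p.2 + p.1)).measurable.coe_nnreal_ennreal.aemeasurable

theorem infDist_midpoint_le {E : Type*} [NormedAddCommGroup E] [NormedSpace ℝ E] {S : Set E}
    (hS : Convex ℝ S) (hne : S.Nonempty) (x y : E) :
    2 * infDist (midpoint ℝ x y) S ≤ infDist x S + infDist y S := by
  refine le_of_forall_pos_le_add fun ε hε => ?_
  obtain ⟨a, ha, hxa⟩ := (infDist_lt_iff hne).1 (lt_add_of_pos_right (infDist x S) (half_pos hε))
  obtain ⟨b, hb, hyb⟩ := (infDist_lt_iff hne).1 (lt_add_of_pos_right (infDist y S) (half_pos hε))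
  have h1 := infDist_le_dist_of_mem (x := midpoint ℝ x y) (hS.midpoint_mem ha hb)
  have h2 := dist_midpoint_midpoint_le x y a b
  linarith

theorem coe_thickenedIndicator_eq_max {E : Type*} [PseudoMetricSpace E] {S : Set E}
    (hne : S.Nonempty) {δ : ℝ} (hδ : 0 < δ) (x : E) :
    (thickenedIndicator hδ S x : ℝ) = max 0 (1 - infDist x S / δ) := by
  rw [thickenedIndicator_apply, thickenedIndicatorAux,
    ← ENNReal.ofReal_toReal (infEDist_ne_top hne), ← ENNReal.ofReal_div_of_pos hδ,
    ← ENNReal.ofReal_one, ← ENNReal.ofReal_sub _ (by positivity)]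
  rw [ENNReal.coe_toNNReal_eq_toReal, ENNReal.toReal_ofReal', max_comm]
  rfl

/-- The thickened indicator of a convex set is midpoint log-concave, as the positive part of the
concave function `1 - infDist x S / δ`. -/
theorem thickenedIndicator_mul_le_sq {E : Type*} [NormedAddCommGroup E] [NormedSpace ℝ E]
    {S : Set E} (hS : Convex ℝ S) (hne : S.Nonempty) {δ : ℝ} (hδ : 0 < δ) (x y : E) :
    thickenedIndicator hδ S x * thickenedIndicator hδ S y ≤
      thickenedIndicator hδ S (midpoint ℝ x y) ^ 2 := by
  rw [← NNReal.coe_le_coe]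
  push_cast
  simp only [coe_thickenedIndicator_eq_max hne]
  have key : 2 * (infDist (midpoint ℝ x y) S / δ) ≤ infDist x S / δ + infDist y S / δ := by
    rw [← add_div, ← mul_div_assoc]
    gcongr
    exact infDist_midpoint_le hS hne x y
  set a := infDist x S / δ
  set b := infDist y S / δ
  set c := infDist (midpoint ℝ x y) S / δ
  rcases le_total 1 a with ha | ha
  · rw [max_eq_left (by linarith : 1 - a ≤ 0)]
    nlinarith [sq_nonneg (max 0 (1 - c))]
  rcases le_total 1 b with hb | hb
  · rw [max_eq_left (by linarith : 1 - b ≤ 0)]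
    nlinarith [sq_nonneg (max 0 (1 - c))]
  rw [max_eq_right (by linarith : 0 ≤ 1 - a), max_eq_right (by linarith : 0 ≤ 1 - b),
    max_eq_right (by linarith : 0 ≤ 1 - c)]
  nlinarith [sq_nonneg (a - b)]

theorem IsSymmetricSet.neg_mem_iff {n : ℕ} {S : Set (Fin n → ℝ)} (hS : IsSymmetricSet S)
    (x : Fin n → ℝ) : -x ∈ S ↔ x ∈ S :=
  ⟨fun h => by simpa using hS _ h, hS x⟩

theorem thickenedIndicator_neg {n : ℕ} {S : Set (Fin n → ℝ)} (hS : IsSymmetricSet S) {δ : ℝ}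
    (hδ : 0 < δ) (x : Fin n → ℝ) :
    thickenedIndicator hδ S (-x) = thickenedIndicator hδ S x := by
  have hS' : -S = S := Set.ext hS.neg_mem_iff
  have : infEDist (-x) S = infEDist x S := by
    conv_lhs => rw [← hS', ← Set.image_neg_eq_neg]
    exact infEDist_image (IsometryEquiv.neg (Fin n → ℝ)).isometry
  simp only [thickenedIndicator_apply, thickenedIndicatorAux, this]

theorem lintegral_cond_eq {n : ℕ} {C : Set (Fin n → ℝ)} (hC : MeasurableSet C)
    (f : (Fin n → ℝ) → ℝ≥0∞) :
    ∫⁻ w, f w ∂(ProbabilityTheory.cond volume C) = (volume C)⁻¹ * ∫⁻ w, C.indicator f w := by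
  rw [ProbabilityTheory.cond, lintegral_smul_measure, lintegral_indicator hC, smul_eq_mul]

/-- The comparison for a disturbance that is uniform on a symmetric convex body. By Fubini the
average over the disturbance is taken first; Prékopa–Leindler makes the result log-concave. -/
theorem lintegral_translationAverage_le_of_mem_symmetricUniforms {n : ℕ}
    {ν' ν : Measure (Fin n → ℝ)} [IsFiniteMeasure ν'] [IsFiniteMeasure ν] (hν : PeakedLE ν' ν)
    {S : Set (Fin n → ℝ)} (hSc : Convex ℝ S) (hSs : IsSymmetricSet S) (hne : S.Nonempty) {δ : ℝ}
    (hδ : 0 < δ) {ρ : FiniteMeasure (Fin n → ℝ)} (hρ : ρ ∈ symmetricUniforms n) :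
    ∫⁻ w, translationAverage ν' (thickenedIndicator hδ S) w ∂(ρ : Measure (Fin n → ℝ)) ≤
      ∫⁻ w, translationAverage ν (thickenedIndicator hδ S) w ∂(ρ : Measure (Fin n → ℝ)) := by
  obtain ⟨C, ⟨hCs, hCc, hCk, -⟩, hC⟩ := hρ
  set f := thickenedIndicator hδ S with hf
  -- integrate over the disturbance first
  rw [lintegral_translationAverage_comm ν', lintegral_translationAverage_comm ν]
  have havg : ∀ y, (translationAverage (ρ : Measure (Fin n → ℝ)) f y : ℝ≥0∞) =
      (volume C)⁻¹ * ∫⁻ w, C.indicator (fun w => (f (w + y) : ℝ≥0∞)) w := fun y => by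
    rw [coe_translationAverage, hC, lintegral_cond_eq hCk.measurableSet]
  have hmeas : ∀ y, Measurable (C.indicator fun w => (f (w + y) : ℝ≥0∞)) := fun y =>
    (by fun_prop : Continuous fun w => f (w + y)).measurable.coe_nnreal_ennreal.indicator
      hCk.measurableSet
  refine hν.lintegral_le
    (translationAverage (ρ : Measure (Fin n → ℝ)) f).continuous (fun y => ?_) fun x y => ?_
  · rw [← ENNReal.coe_inj, havg, havg, ← lintegral_neg_eq_self]
    congr 2
    ext w
    by_cases hw : w ∈ C
    · rw [Set.indicator_of_mem hw, Set.indicator_of_mem ((hCs.neg_mem_iff w).2 hw), ← neg_add,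
        hf, thickenedIndicator_neg hSs]
    · rw [Set.indicator_of_notMem hw, Set.indicator_of_notMem (mt (hCs.neg_mem_iff w).1 hw)]
  · rw [← ENNReal.coe_le_coe]
    push_cast
    rw [havg, havg, havg, mul_pow, mul_mul_mul_comm, ← sq]
    gcongr
    refine prekopaLeindler (hmeas x) (hmeas y) (hmeas _) fun v w => ?_
    by_cases hv : v ∈ C
    swap
    · simp [hv]
    by_cases hw : w ∈ C
    swap
    · simp [hw]
    rw [Set.indicator_of_mem hv, Set.indicator_of_mem hw,
      Set.indicator_of_mem (hCc.midpoint_mem hv hw),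
      show midpoint ℝ v w + midpoint ℝ x y = midpoint ℝ (v + x) (w + y) by
        simp only [midpoint_eq_smul_add, smul_add]; abel]
    exact_mod_cast thickenedIndicator_mul_le_sq hSc hne hδ (v + x) (w + y)

theorem isClosed_setOf_testAgainstNN_le {n : ℕ} (f g : (Fin n → ℝ) →ᵇ ℝ≥0) :
    IsClosed {ρ : FiniteMeasure (Fin n → ℝ) | ρ.testAgainstNN f ≤ ρ.testAgainstNN g} :=
  isClosed_le (FiniteMeasure.continuous_testAgainstNN_eval f)
    (FiniteMeasure.continuous_testAgainstNN_eval g)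

theorem convex_setOf_testAgainstNN_le {n : ℕ} (f g : (Fin n → ℝ) →ᵇ ℝ≥0) :
    Convex ℝ≥0 {ρ : FiniteMeasure (Fin n → ℝ) | ρ.testAgainstNN f ≤ ρ.testAgainstNN g} := by
  have hadd : ∀ (ρ σ : FiniteMeasure (Fin n → ℝ)) (h : (Fin n → ℝ) →ᵇ ℝ≥0),
      (ρ + σ).testAgainstNN h = ρ.testAgainstNN h + σ.testAgainstNN h := fun ρ σ h => by
    rw [← ENNReal.coe_inj]
    push_cast
    simp [FiniteMeasure.testAgainstNN_coe_eq, lintegral_add_measure]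
  intro ρ hρ σ hσ a b _ _ _
  simp only [Set.mem_ofPred_eq, hadd, FiniteMeasure.smul_testAgainstNN_apply] at *
  gcongr

/-- Adding an independent central convex unimodal disturbance preserves the peakedness order. -/
theorem PeakedLE.conv {n : ℕ} {ν' ν : Measure (Fin n → ℝ)} [IsFiniteMeasure ν']
    [IsFiniteMeasure ν] (hν : PeakedLE ν' ν) {μ : ProbabilityMeasure (Fin n → ℝ)}
    (hμ : IsCentralConvexUnimodal μ) :
    PeakedLE (ν' ∗ (μ : Measure (Fin n → ℝ))) (ν ∗ (μ : Measure (Fin n → ℝ))) := by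
  intro S hScl hSc hSs
  rcases S.eq_empty_or_nonempty with rfl | hne
  · simp
  have hconv : ∀ (η : Measure (Fin n → ℝ)) [IsFiniteMeasure η] (f : (Fin n → ℝ) →ᵇ ℝ≥0),
      ∫⁻ x, f x ∂(η ∗ (μ : Measure (Fin n → ℝ))) =
        μ.toFiniteMeasure.testAgainstNN (translationAverage η f) := fun η _ f => by
    rw [Measure.lintegral_conv f.continuous.measurable.coe_nnreal_ennreal,
      lintegral_lintegral_swap, FiniteMeasure.testAgainstNN_coe_eq]
    · simp_rw [coe_translationAverage]
      rfl
    · exact (by fun_prop : Continuous fun p : (Fin n → ℝ) × (Fin n → ℝ) =>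
        f (p.1 + p.2)).measurable.coe_nnreal_ennreal.aemeasurable
  obtain ⟨δ, -, hδ, hlim⟩ := exists_seq_strictAnti_tendsto (0 : ℝ)
  refine le_of_tendsto_of_tendsto'
    (tendsto_lintegral_thickenedIndicator_of_isClosed _ hScl hδ hlim)
    (tendsto_lintegral_thickenedIndicator_of_isClosed _ hScl hδ hlim) fun k => ?_
  set f := thickenedIndicator (hδ k) S with hf
  rw [hconv, hconv, ENNReal.coe_le_coe]
  -- the condition on the disturbance law is closed and convex, so the generators suffice
  refine closure_minimal (convexHull_min ?_ (convex_setOf_testAgainstNN_le _ _))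
    (isClosed_setOf_testAgainstNN_le (translationAverage ν' f) (translationAverage ν f)) hμ
  intro ρ hρ
  simp only [Set.mem_ofPred_eq, ← ENNReal.coe_le_coe, FiniteMeasure.testAgainstNN_coe_eq]
  exact lintegral_translationAverage_le_of_mem_symmetricUniforms hν hSc hSs hne (hδ k) hρ

/-! ### From closed sets to measurable sets -/

/-- By Carathéodory's theorem the convex hull of a compact set is a finite union of continuous
images of the compact sets `stdSimplex × K ^ m`. -/
theorem isCompact_convexHull_of_isCompact {E : Type*} [NormedAddCommGroup E] [NormedSpace ℝ E]
    [FiniteDimensional ℝ E] {K : Set E} (hK : IsCompact K) : IsCompact (convexHull ℝ K) := by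
  let σ : ∀ m : ℕ, (Fin m → ℝ) × (Fin m → E) → E := fun m p => ∑ i, p.1 i • p.2 i
  have hσ : ∀ m, Continuous (σ m) := fun m => by fun_prop
  have heq : convexHull ℝ K = ⋃ m ∈ Finset.range (Module.finrank ℝ E + 2),
      σ m '' (stdSimplex ℝ (Fin m) ×ˢ Set.univ.pi fun _ => K) := by
    refine Set.Subset.antisymm (fun x hx => ?_) (Set.iUnion₂_subset fun m _ => ?_)
    · obtain ⟨ι, _, z, w, hz, hind, hw, hw1, rfl⟩ := eq_pos_convex_span_of_mem_convexHull hx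
      have hcard := hind.card_le_finrank_succ
      have hsub := Submodule.finrank_le (vectorSpan ℝ (Set.range z))
      let e := Fintype.equivFin ι
      refine Set.mem_iUnion₂.2 ⟨Fintype.card ι, Finset.mem_range.2 (by omega), ?_⟩
      refine ⟨(w ∘ e.symm, z ∘ e.symm), ⟨⟨fun i => (hw _).le, ?_⟩, fun i _ => hz ⟨_, rfl⟩⟩, ?_⟩
      · exact (e.symm.sum_comp w).trans hw1
      · exact e.symm.sum_comp fun i => w i • z i
    · rintro _ ⟨⟨w, z⟩, ⟨hw, hz⟩, rfl⟩
      exact (convex_convexHull ℝ K).sum_mem (fun i _ => hw.1 i) hw.2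
        fun i _ => subset_convexHull ℝ K (hz i (Set.mem_univ i))
  rw [heq]
  exact (Finset.range _).isCompact_biUnion fun m _ =>
    ((isCompact_stdSimplex ℝ (Fin m)).prod (isCompact_univ_pi fun _ => hK)).image (hσ m)

/-- The comparison of masses holds for all measurable convex symmetric sets `S`: a compact `L ⊆ S` is
enlarged to the compact convex symmetric set `convexHull (L ∪ -L) ⊆ S`. -/
theorem PeakedLE.measure_le {n : ℕ} {ν' ν : Measure (Fin n → ℝ)} [IsFiniteMeasure ν']
    (hν : PeakedLE ν' ν) {S : Set (Fin n → ℝ)} (hSm : MeasurableSet S) (hSc : Convex ℝ S)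
    (hSs : IsSymmetricSet S) : ν' S ≤ ν S := by
  rw [hSm.measure_eq_iSup_isCompact]
  refine iSup₂_le fun L hLS => iSup_le fun hL => ?_
  have hcpt := isCompact_convexHull_of_isCompact (hL.union hL.neg)
  have hneg : -L ⊆ S := fun x hx => (hSs.neg_mem_iff x).1 (hLS hx)
  calc ν' L ≤ ν' (convexHull ℝ (L ∪ -L)) :=
        measure_mono (Set.subset_union_left.trans (subset_convexHull ℝ _))
    _ ≤ ν (convexHull ℝ (L ∪ -L)) := by
        refine hν _ hcpt.isClosed (convex_convexHull ℝ _) fun x hx => ?_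
        rw [← Set.mem_neg, ← convexHull_neg, Set.union_neg, neg_neg, Set.union_comm]
        exact hx
    _ ≤ ν S := measure_mono (convexHull_min (Set.union_subset hLS hneg) hSc)

theorem PeakedLE.map_mulVec {n : ℕ} {ν' ν : Measure (Fin n → ℝ)} (hν : PeakedLE ν' ν)
    (A : Matrix (Fin n) (Fin n) ℝ) : PeakedLE (ν'.map (A *ᵥ ·)) (ν.map (A *ᵥ ·)) := by
  intro S hScl hSc hSs
  have hA : Continuous (A *ᵥ ·) := by fun_prop
  rw [Measure.map_apply hA.measurable hScl.measurableSet,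
    Measure.map_apply hA.measurable hScl.measurableSet]
  refine hν _ (hScl.preimage hA) (hSc.linear_preimage (Matrix.mulVecLin A)) fun x hx => ?_
  simpa [Matrix.mulVec_neg] using hSs _ hx

/-! ### Causality and recursion of the error processes -/

namespace Problem

variable {nx nu N : ℕ} (M : Problem nx nu N)

/-- The closed loop is causal: its state at time `k` depends only on the disturbances before `k`. -/
theorem closedLoop_congr (κ : (Fin nx → ℝ) → Fin nu → ℝ) (x0 : Fin nx → ℝ)
    {w w' : ℕ → Fin nx → ℝ} {k : ℕ} (h : ∀ j < k, w j = w' j) :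
    M.closedLoop κ x0 w k = M.closedLoop κ x0 w' k := by
  induction k with
  | zero => rfl
  | succ k ih =>
    rw [closedLoop, closedLoop, ih fun j hj => h j (hj.trans k.lt_succ_self), h k k.lt_succ_self]

theorem predictedError_congr {w w' : ℕ → Fin nx → ℝ} {k : ℕ} (h : ∀ j < k, w j = w' j) :
    M.predictedError w k = M.predictedError w' k := by
  induction k with
  | zero => rfl
  | succ k ih =>
    simp only [predictedError, ih fun j hj => h j (hj.trans k.lt_succ_self), h k k.lt_succ_self]

theorem measurable_closedLoop {κ : (Fin nx → ℝ) → Fin nu → ℝ} (hκ : Measurable κ)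
    (hF : MeasurableSet {z | M.Feasible z}) (x0 : Fin nx → ℝ) (k : ℕ) :
    Measurable fun w : ℕ → Fin nx → ℝ => M.closedLoop κ x0 w k := by
  have hmul : ∀ {m l : ℕ} (A : Matrix (Fin m) (Fin l) ℝ), Measurable fun v => A *ᵥ v :=
    fun A => (by fun_prop : Continuous fun v => A *ᵥ v).measurable
  induction k with
  | zero => exact measurable_const
  | succ k ih =>
    have hx := ih.fst
    have hz := ih.snd
    have hv := hκ.comp hz
    have hxn := (((hmul M.A).comp hx).add
      ((hmul M.B).comp (hv.add ((hmul M.K).comp (hx.sub hz))))).add (measurable_pi_apply k)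
    exact hxn.prodMk (Measurable.ite (hxn hF) hxn (((hmul M.A).comp hz).add ((hmul M.B).comp hv)))

theorem measurable_closedLoopError {κ : (Fin nx → ℝ) → Fin nu → ℝ} (hκ : Measurable κ)
    (hF : MeasurableSet {z | M.Feasible z}) (x0 : Fin nx → ℝ) (k : ℕ) :
    Measurable fun w : ℕ → Fin nx → ℝ => M.closedLoopError κ x0 w k :=
  (M.measurable_closedLoop hκ hF x0 k).fst.sub (M.measurable_closedLoop hκ hF x0 k).snd

theorem measurable_predictedError (k : ℕ) :
    Measurable fun w : ℕ → Fin nx → ℝ => M.predictedError w k := by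
  induction k with
  | zero => exact measurable_const
  | succ k ih =>
    exact ((by fun_prop : Continuous fun v => M.AK *ᵥ v).measurable.comp ih).add
      (measurable_pi_apply k)

/-- The closed-loop error is either reset to zero or follows the linear error dynamics. -/
theorem closedLoopError_succ (κ : (Fin nx → ℝ) → Fin nu → ℝ) (x0 : Fin nx → ℝ)
    (w : ℕ → Fin nx → ℝ) (k : ℕ) :
    M.closedLoopError κ x0 w (k + 1) = 0 ∨
      M.closedLoopError κ x0 w (k + 1) = M.AK *ᵥ M.closedLoopError κ x0 w k + w k := by
  simp only [closedLoopError, closedLoop]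
  split_ifs
  · left
    simp
  · right
    simp only [AK, Matrix.add_mulVec, ← Matrix.mulVec_mulVec, Matrix.mulVec_add, Matrix.mulVec_sub]
    abel

end Problem

/-- If `Φ` depends only on the disturbances before time `k`, then `Φ` and the disturbance at time `k`
are independent, so the law of their sum is a convolution. -/
theorem IsIIDWithLaw.map_add_eq_conv {n : ℕ} {Ω : Type*} [MeasurableSpace Ω] {P : Measure Ω}
    [IsProbabilityMeasure P] {w : ℕ → Ω → Fin n → ℝ} {μ : ProbabilityMeasure (Fin n → ℝ)}
    (hw : IsIIDWithLaw P w μ) {k : ℕ} {Φ : (ℕ → Fin n → ℝ) → Fin n → ℝ} (hΦ : Measurable Φ)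
    (hcongr : ∀ v v' : ℕ → Fin n → ℝ, (∀ j < k, v j = v' j) → Φ v = Φ v') :
    P.map (fun ω => Φ (fun j => w j ω) + w k ω) =
      P.map (fun ω => Φ (fun j => w j ω)) ∗ (μ : Measure (Fin n → ℝ)) := by
  obtain ⟨hm, hind, hlaw⟩ := hw
  have hext : Measurable fun (v : Finset.range k → Fin n → ℝ) (j : ℕ) =>
      if h : j ∈ Finset.range k then v ⟨j, h⟩ else 0 := by
    refine measurable_pi_lambda _ fun j => ?_
    by_cases h : j ∈ Finset.range k
    · simpa only [h, dite_true] using measurable_pi_apply _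
    · simpa only [h, dite_false] using measurable_const
  have hΦeq : (fun ω => Φ fun j => w j ω) = (fun v : Finset.range k → Fin n → ℝ =>
      Φ fun j => if h : j ∈ Finset.range k then v ⟨j, h⟩ else 0) ∘
        fun ω (i : Finset.range k) => w i ω := by
    ext1 ω
    refine hcongr _ _ fun j hj => ?_
    simp [hj]
  have hI : IndepFun (fun ω => Φ fun j => w j ω) (w k) P := by
    rw [hΦeq]
    exact (hind.indepFun_finset (Finset.range k) {k} (by simp) hm).comp (hΦ.comp hext)
      (measurable_pi_apply (⟨k, Finset.mem_singleton_self k⟩ : ({k} : Finset ℕ)))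
  rw [← hlaw k]
  exact hI.map_add_eq_map_conv_map (hΦ.comp (measurable_pi_lambda _ hm)) (hm k)

/-! ### Comparison of the error laws -/

theorem peakedLE_map_predictedError_map_closedLoopError {nx nu N : ℕ} (M : Problem nx nu N)
    {κ : (Fin nx → ℝ) → Fin nu → ℝ} (hκm : Measurable κ)
    (hfm : MeasurableSet {z | M.Feasible z}) (x0 : Fin nx → ℝ)
    {μ : ProbabilityMeasure (Fin nx → ℝ)} (hμ : IsCentralConvexUnimodal μ)
    {Ω : Type*} [MeasurableSpace Ω] {P : Measure Ω} [IsProbabilityMeasure P]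
    {w : ℕ → Ω → Fin nx → ℝ} (hw : IsIIDWithLaw P w μ)
    {Ω' : Type*} [MeasurableSpace Ω'] {P' : Measure Ω'} [IsProbabilityMeasure P']
    {w' : ℕ → Ω' → Fin nx → ℝ} (hw' : IsIIDWithLaw P' w' μ) (k : ℕ) :
    PeakedLE (P'.map fun ω' => M.predictedError (fun j => w' j ω') k)
      (P.map fun ω => M.closedLoopError κ x0 (fun j => w j ω) k) := by
  have hAK : Measurable fun v => M.AK *ᵥ v :=
    (by fun_prop : Continuous fun v => M.AK *ᵥ v).measurable
  have hW : Measurable fun ω j => w j ω := measurable_pi_lambda _ hw.1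
  have hW' : Measurable fun ω' j => w' j ω' := measurable_pi_lambda _ hw'.1
  have hE : ∀ k, Measurable fun ω => M.closedLoopError κ x0 (fun j => w j ω) k := fun k =>
    (M.measurable_closedLoopError hκm hfm x0 k).comp hW
  have hE' : ∀ k, Measurable fun ω' => M.predictedError (fun j => w' j ω') k := fun k =>
    (M.measurable_predictedError k).comp hW'
  induction k with
  | zero => simp [Problem.predictedError, Problem.closedLoopError, Problem.closedLoop, PeakedLE]
  | succ k ih =>
    intro S hScl hSc hSs
    rcases S.eq_empty_or_nonempty with rfl | ⟨s, hs⟩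
    · simp
    have h0 : (0 : Fin nx → ℝ) ∈ S := by
      have := hSc.midpoint_mem hs (hSs s hs)
      rwa [midpoint_self_neg] at this
    have hstep := (ih.map_mulVec M.AK).conv hμ
    have hmap := Measure.map_map (μ := P) hAK (hE k)
    have hmap' := Measure.map_map (μ := P') hAK (hE' k)
    simp only [Function.comp_def] at hmap hmap'
    have hconv := hw.map_add_eq_conv (k := k)
      (Φ := fun v => M.AK *ᵥ M.closedLoopError κ x0 v k)
      (hAK.comp (M.measurable_closedLoopError hκm hfm x0 k)) fun v v' h => by
        simp only [Problem.closedLoopError, M.closedLoop_congr κ x0 h]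
    have hconv' := hw'.map_add_eq_conv (k := k) (Φ := fun v => M.AK *ᵥ M.predictedError v k)
      (hAK.comp (M.measurable_predictedError k)) fun v v' h => by
        simp only [M.predictedError_congr h]
    rw [hmap, hmap', ← hconv, ← hconv'] at hstep
    refine (hstep S hScl hSc hSs).trans ?_
    have hsum : Measurable fun ω =>
        M.AK *ᵥ M.closedLoopError κ x0 (fun j => w j ω) k + w k ω :=
      (hAK.comp (hE k)).add (hw.1 k)
    rw [Measure.map_apply hsum hScl.measurableSet,
      Measure.map_apply (hE (k + 1)) hScl.measurableSet]
    -- a reset puts the error at `0 ∈ S`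
    refine measure_mono fun ω hω => ?_
    rcases M.closedLoopError_succ κ x0 (fun j => w j ω) k with h | h
    · simpa [h] using h0
    · simpa [h] using hω

end StochasticMPC

theorem mainTheorem1 {nx nu N : ℕ} [NeZero N] (M : StochasticMPC.Problem nx nu N)
    (hM : M.StandingAssumptions)
    (κ : (Fin nx → ℝ) → Fin nu → ℝ) (hκ : M.IsMPCLaw κ) (hκm : Measurable κ)
    (hfm : MeasurableSet {z | M.Feasible z})
    (x0 : Fin nx → ℝ) (hx0 : M.Feasible x0)
    (μ : ProbabilityMeasure (Fin nx → ℝ)) (hμ : StochasticMPC.IsCentralConvexUnimodal μ)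
    -- the disturbances acting on the closed loop
    {Ω : Type*} [MeasurableSpace Ω] (P : Measure Ω) [IsProbabilityMeasure P]
    (w : ℕ → Ω → Fin nx → ℝ) (hw : StochasticMPC.IsIIDWithLaw P w μ)
    -- the disturbances used in the prediction
    {Ω' : Type*} [MeasurableSpace Ω'] (P' : Measure Ω') [IsProbabilityMeasure P']
    (w' : ℕ → Ω' → Fin nx → ℝ) (hw' : StochasticMPC.IsIIDWithLaw P' w' μ)
    (R : Set (Fin nx → ℝ)) (hRm : MeasurableSet R) (hRc : Convex ℝ R)
    (hRs : StochasticMPC.IsSymmetricSet R) :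
    (∀ k : ℕ,
      P.real {ω | M.closedLoopError κ x0 (fun j => w j ω) k ∈ R} ≥
        P'.real {ω' | M.predictedError (fun j => w' j ω') k ∈ R}) ∧
    (∀ p : ℝ,
      StochasticMPC.IsPRS P' (fun k ω' => M.predictedError (fun j => w' j ω') k) R p →
      StochasticMPC.IsPRS P (fun k ω => M.closedLoopError κ x0 (fun j => w j ω) k) R p) := by
  have key : ∀ k : ℕ,
      P.real {ω | M.closedLoopError κ x0 (fun j => w j ω) k ∈ R} ≥
        P'.real {ω' | M.predictedError (fun j => w' j ω') k ∈ R} := fun k => by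
    have hE : Measurable fun ω => M.closedLoopError κ x0 (fun j => w j ω) k :=
      (M.measurable_closedLoopError hκm hfm x0 k).comp (measurable_pi_lambda _ hw.1)
    have hE' : Measurable fun ω' => M.predictedError (fun j => w' j ω') k :=
      (M.measurable_predictedError k).comp (measurable_pi_lambda _ hw'.1)
    have := Measure.isProbabilityMeasure_map (μ := P') hE'.aemeasurable
    have h := (StochasticMPC.peakedLE_map_predictedError_map_closedLoopError M hκm hfm x0 hμ hw hw'
      k).measure_le hRm hRc hRs
    rw [Measure.map_apply hE hRm, Measure.map_apply hE' hRm] at h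
    exact ENNReal.toReal_mono (measure_ne_top P _) h
  exact ⟨key, fun p hp => ⟨fun ω => by
    simp [StochasticMPC.Problem.closedLoopError, StochasticMPC.Problem.closedLoop],
    fun k => (hp.2 k).trans (key k)⟩⟩
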